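/- Permutations are written in one-line notation; $\mathfrak{S}_n$ is the set of permutations of $\{1,\dots,n\}$ (with $\mathfrak S_0$ consisting of the empty permutation) and $\mathfrak{S}=\bigsqcup_{n\ge 0}\mathfrak{S}_n$. Let $\Gamma\subseteq\mathfrak{S}$ be a (finite or infinite) set of permutations, each of length at least $2$. An occurrence of $\sigma\in\mathfrak S_m$ in $\pi\in\mathfrak S_n$ is a position $i$ with $1\le i\le n-m+1$ such that $\pi_i\pi_{i+1}\cdots\pi_{i+m-1}$ is in the same relative order as $\sigma$ (that is, it standardizes to $\sigma$); $\operatorname{occ}_\Gamma(\pi)$ is the total number of occurrences in $\pi$ of permutations in $\Gamma$. A left peak of $\pi\in\mathfrak S_n$ is an index $1\le i\le n-1$ with $\pi_i>\pi_{i+1}$ and either $i=1$ or $\pi_{i-1}<\pi_i$; $\operatorname{lpk}(\pi)$ is the number of left peaks, and $\operatorname{ilpk}(\pi)=\operatorname{lpk}(\pi^{-1})$. A marked permutation is a pair $(\pi,T)$ with $\pi\in\mathfrak S$ and $T$ any set of pairs $(i,\sigma)$ such that $\sigma\in\Gamma$ occurs in $\pi$ at position $i$. It is a concatenation of marked permutations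 $(\alpha,U)$ and $(\beta,V)$, of lengths $a$ and $b$, if $\pi$ has length $a+b$, its first $a$ letters standardize to $\alpha$, its last $b$ letters standardize to $\beta$, and $T=U\cup\{(a+i,\sigma):(i,\sigma)\in V\}$. A $\Gamma$-cluster on $\pi$ is a marked permutation $c=(\pi,T)$ that is not a concatenation of two nonempty marked permutations; $\operatorname{mk}_\Gamma(c)=|T|$, and $C_{\Gamma,\pi}$ is the set of $\Gamma$-clusters on $\pi$. Put $P^{\operatorname{ilpk}}_{\Gamma,0}(s,t)=1$ and $$P^{\operatorname{ilpk}}_{\Gamma,n}(s,t)=\sum_{\pi\in\mathfrak S_n}s^{\operatorname{occ}_\Gamma(\pi)}t^{\operatorname{ilpk}(\pi)}\quad(n\ge 1),\qquad R^{\operatorname{ilpk}}_{\Gamma,k}(s,t)=\sum_{\pi\in\mathfrak S_k}t^{\operatorname{ilpk}(\pi)}\sum_{c\in C_{\Gamma,\pi}}s^{\operatorname{mk}_\Gamma(c)}\quad(k\ge 2).$$ For formal power series in $t$ and $x$ over $\mathbb{Q}[s]$, let $*$ be the Hadamard product in $t$, $\big(\sum_n a_nt^n\big)*\big(\sum_n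 b_nt^n\big)=\sum_n a_nb_nt^n$ with $a_n,b_n\in\mathbb{Q}[s][[x]]$, and let $f^{*\langle n\rangle}$ be the $n$-fold Hadamard product of $f$, so that $f^{*\langle 0\rangle}=1/(1-t)$. Then $$\frac{1}{1-t}\sum_{n=0}^{\infty}P^{\operatorname{ilpk}}_{\Gamma,n}(s,u)\,z^n=\sum_{n=0}^{\infty}\left(\frac{z}{1-t}+\frac{1}{1-t}\sum_{k=2}^{\infty}R^{\operatorname{ilpk}}_{\Gamma,k}(s-1,u)\,z^k\right)^{*\langle n\rangle}$$ as formal power series in $t$ and $x$ over $\mathbb{Q}[s]$, where $u=4t/(1+t)^2$ and $z=(1+t)x/(1-t)$; all infinite sums converge formally (each monomial $t^ix^j$ occurs in only finitely many terms). -/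

import Mathlib

namespace ClusterMethod

/-! ### Permutations, consecutive patterns, inverse left peaks -/

/-- The set `𝔖 = ⨆ₘ 𝔖ₘ` of all permutations of all lengths.  A permutation `π ∈ 𝔖ₙ` is a
permutation of `Fin n`, so positions and letters are numbered from `0`. -/
abbrev AllPerm : Type := Σ m : ℕ, Equiv.Perm (Fin m)

/-- The `m` consecutive letters of `π` starting at position `i` exist and standardize to `σ`,
that is, they are in the same relative order as the letters of `σ`. -/
def IsOccAt {m n : ℕ} (σ : Equiv.Perm (Fin m)) (π : Equiv.Perm (Fin n)) (i : ℕ) : Prop :=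
  ∃ h : i + m ≤ n, ∀ a b : Fin m,
    σ a < σ b ↔
      π ⟨i + a, lt_of_lt_of_le (Nat.add_lt_add_left a.isLt i) h⟩ <
        π ⟨i + b, lt_of_lt_of_le (Nat.add_lt_add_left b.isLt i) h⟩

/-- The occurrences `(i, σ)` in `π` of patterns `σ ∈ Γ`, with `i` the starting position. -/
def occSet (Γ : Set AllPerm) {n : ℕ} (π : Equiv.Perm (Fin n)) : Set (ℕ × AllPerm) :=
  {o | o.2 ∈ Γ ∧ IsOccAt o.2.2 π o.1}

theorem occSet_finite (Γ : Set AllPerm) {n : ℕ} (π : Equiv.Perm (Fin n)) :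
    (occSet Γ π).Finite := by
  refine (Set.finite_range (fun p : Fin (n + 1) × (Σ m : Fin (n + 1), Equiv.Perm (Fin m)) =>
    ((p.1 : ℕ), (⟨(p.2.1 : ℕ), p.2.2⟩ : AllPerm)))).subset ?_
  rintro ⟨i, m, σ⟩ ⟨-, h, -⟩
  have h' : i + m ≤ n := h
  exact ⟨(⟨i, by omega⟩, ⟨⟨m, by omega⟩, σ⟩), rfl⟩

/-- The finite set of occurrences in `π` of patterns in `Γ`. -/
noncomputable def occurrences (Γ : Set AllPerm) {n : ℕ} (π : Equiv.Perm (Fin n)) :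
    Finset (ℕ × AllPerm) :=
  (occSet_finite Γ π).toFinset

/-- `occ_Γ(π)`: the number of occurrences in `π` of patterns in `Γ`. -/
noncomputable def occ (Γ : Set AllPerm) {n : ℕ} (π : Equiv.Perm (Fin n)) : ℕ :=
  (occurrences Γ π).card

/-- Position `i` is a descent of `π`. -/
def IsDescent {n : ℕ} (π : Equiv.Perm (Fin n)) (i : Fin n) : Prop :=
  ∃ h : (i : ℕ) + 1 < n, π ⟨i + 1, h⟩ < π i

/-- Position `i` is a peak of `π`: it is neither the first nor the last position, and its letter
is larger than both neighbours. -/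
def IsPeak {n : ℕ} (π : Equiv.Perm (Fin n)) (i : Fin n) : Prop :=
  0 < (i : ℕ) ∧ π ⟨i - 1, lt_of_le_of_lt (Nat.sub_le _ _) i.isLt⟩ < π i ∧ IsDescent π i

/-- Position `i` is a left peak of `π`: a peak, or the first position if it is a descent. -/
def IsLeftPeak {n : ℕ} (π : Equiv.Perm (Fin n)) (i : Fin n) : Prop :=
  IsPeak π i ∨ ((i : ℕ) = 0 ∧ IsDescent π i)

open Classical in
/-- The left peak number. -/
noncomputable def lpk {n : ℕ} (π : Equiv.Perm (Fin n)) : ℕ :=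
  (Finset.univ.filter (fun i : Fin n => IsLeftPeak π i)).card

/-- The inverse left peak number. -/
noncomputable def ilpk {n : ℕ} (π : Equiv.Perm (Fin n)) : ℕ :=
  lpk π⁻¹

/-! ### Marked permutations and clusters -/

/-- `(π, T)` is a marked permutation with respect to `Γ`: `T` is any set of occurrences in `π`
of patterns in `Γ`. -/
def IsMarked (Γ : Set AllPerm) {n : ℕ} (π : Equiv.Perm (Fin n)) (T : Finset (ℕ × AllPerm)) :
    Prop :=
  T ⊆ occurrences Γ π

/-- `(π, T)` is a concatenation of `(α, U)` and `(β, V)`: the first letters of `π` standardize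
to `α`, the remaining letters standardize to `β`, and `T` consists of the marked occurrences in
`U` together with those in `V`, the latter shifted by the length of `α`. -/
def IsConcat {n a b : ℕ} (π : Equiv.Perm (Fin n)) (T : Finset (ℕ × AllPerm))
    (α : Equiv.Perm (Fin a)) (U : Finset (ℕ × AllPerm))
    (β : Equiv.Perm (Fin b)) (V : Finset (ℕ × AllPerm)) : Prop :=
  n = a + b ∧ IsOccAt α π 0 ∧ IsOccAt β π a ∧
    ∀ o : ℕ × AllPerm, o ∈ T ↔ o ∈ U ∨ ∃ v ∈ V, o = (a + v.1, v.2)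

/-- `(π, T)` is a `Γ`-cluster: a marked permutation that is not a concatenation of two nonempty
marked permutations. -/
def IsCluster (Γ : Set AllPerm) {n : ℕ} (π : Equiv.Perm (Fin n)) (T : Finset (ℕ × AllPerm)) :
    Prop :=
  IsMarked Γ π T ∧
    ¬ ∃ (a b : ℕ) (α : Equiv.Perm (Fin a)) (U : Finset (ℕ × AllPerm))
        (β : Equiv.Perm (Fin b)) (V : Finset (ℕ × AllPerm)),
        0 < a ∧ 0 < b ∧ IsMarked Γ α U ∧ IsMarked Γ β V ∧ IsConcat π T α U β V

open Classical in
/-- `C_{Γ,π}`: the `Γ`-clusters on `π`, each given by its set of marked occurrences. -/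
noncomputable def clusters (Γ : Set AllPerm) {n : ℕ} (π : Equiv.Perm (Fin n)) :
    Finset (Finset (ℕ × AllPerm)) :=
  (occurrences Γ π).powerset.filter (fun T => IsCluster Γ π T)

/-! ### The polynomials, in the variables `s = X 0` and `t = X 1` -/

/-- `P_{Γ,n}^{ilpk}(s,t) = ∑_{π ∈ 𝔖ₙ} s^{occ_Γ(π)} t^{ilpk(π)}` for `n ≥ 1`, and `1` for
`n = 0`. -/
noncomputable def ilpkPoly (Γ : Set AllPerm) (n : ℕ) : MvPolynomial (Fin 2) ℚ :=
  if n = 0 then 1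
  else ∑ π : Equiv.Perm (Fin n),
    MvPolynomial.X 0 ^ occ Γ π * MvPolynomial.X 1 ^ ilpk π

/-- The refined cluster polynomial
`R_{Γ,k}^{ilpk}(s,t) = ∑_{π ∈ 𝔖ₖ} t^{ilpk(π)} ∑_{c ∈ C_{Γ,π}} s^{mk_Γ(c)}`. -/
noncomputable def ilpkClusterPoly (Γ : Set AllPerm) (k : ℕ) : MvPolynomial (Fin 2) ℚ :=
  ∑ π : Equiv.Perm (Fin k),
    MvPolynomial.X 1 ^ ilpk π * ∑ c ∈ clusters Γ π, MvPolynomial.X 0 ^ c.card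

/-! ### Formal power series in `t` and `x`, and the Hadamard product in `t` -/

/-- The ring `ℚ[s][[x]][[t]]` of formal power series in `t` and `x` with coefficients in
`ℚ[s]`; the outer variable is `t`. -/
abbrev Ser : Type := PowerSeries (PowerSeries (Polynomial ℚ))

/-- The variable `s`. -/
noncomputable def sVar : Ser := PowerSeries.C (PowerSeries.C Polynomial.X)

/-- The variable `t`. -/
noncomputable def tVar : Ser := PowerSeries.X

/-- The variable `x`. -/
noncomputable def xVar : Ser := PowerSeries.C PowerSeries.X

/-- `1 / (1 - t)`. -/
noncomputable def invOneSub : Ser := PowerSeries.invOfUnit (1 - tVar) 1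

/-- `1 / (1 + t)`. -/
noncomputable def invOneAdd : Ser := PowerSeries.invOfUnit (1 + tVar) 1

theorem one_sub_mul_invOneSub : (1 - tVar) * invOneSub = 1 :=
  PowerSeries.mul_invOfUnit _ _ (by simp [tVar])

theorem one_add_mul_invOneAdd : (1 + tVar) * invOneAdd = 1 :=
  PowerSeries.mul_invOfUnit _ _ (by simp [tVar])

/-- `u = 4t / (1 + t)²`. -/
noncomputable def uSer : Ser := 4 * tVar * invOneAdd ^ 2

/-- `z = (1 + t)x / (1 - t)`. -/
noncomputable def zSer : Ser := (1 + tVar) * xVar * invOneSub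

/-- The Hadamard product in `t`: coefficients of equal powers of `t`, which are power series in
`x`, are multiplied. -/
noncomputable def hadamard (f g : Ser) : Ser :=
  PowerSeries.mk fun i => PowerSeries.coeff i f * PowerSeries.coeff i g

/-- The `n`-fold Hadamard product `f^{*⟨n⟩}`; for `n = 0` it is the identity `1 / (1 - t)` of
the Hadamard product. -/
noncomputable def hadamardPow (f : Ser) : ℕ → Ser
  | 0 => invOneSub
  | n + 1 => hadamard (hadamardPow f n) f

/-- A sequence of series is formally summable if each monomial `t^i x^j` has a nonzero
coefficient in only finitely many of its terms. -/
def FormallySummable (f : ℕ → Ser) : Prop :=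
  ∀ i j : ℕ, {n : ℕ | PowerSeries.coeff j (PowerSeries.coeff i (f n)) ≠ 0}.Finite

/-- The sum of a formally summable sequence of series, taken coefficient by coefficient. -/
noncomputable def formalSum (f : ℕ → Ser) : Ser :=
  PowerSeries.mk fun i => PowerSeries.mk fun j =>
    ∑ᶠ n : ℕ, PowerSeries.coeff j (PowerSeries.coeff i (f n))

/-- The terms `P_{Γ,n}^{ilpk}(s,u) z^n`. -/
noncomputable def ilpkTerm (Γ : Set AllPerm) (n : ℕ) : Ser :=
  MvPolynomial.aeval ![sVar, uSer] (ilpkPoly Γ n) * zSer ^ n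

/-- The terms `R_{Γ,k}^{ilpk}(s-1,u) z^k`. -/
noncomputable def ilpkClusterTerm (Γ : Set AllPerm) (k : ℕ) : Ser :=
  MvPolynomial.aeval ![sVar - 1, uSer] (ilpkClusterPoly Γ k) * zSer ^ k

end ClusterMethod

open ClusterMethod

/-! Fix `k` and compare coefficients of `t^k`, where Hadamard powers become ordinary powers. The
bridge is `coeff_invOneSub_mul_pow_ilpk`: in `u^{ilpk π} z^n / (1 - t)` this coefficient is `x^n`
times the number of words over the letters `0, …, 2k` that standardize to `π`, ties being broken
left to right for even letters and right to left for odd ones. Such words correspond to weakly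
increasing sequences whose repetitions are governed by the descents of `π⁻¹`. A transfer argument on
the parity of the last letter (`evenSeries_add_oddSeries`) yields a factor `(1 + t)/(1 - t)` per
letter and `u` per run of descents, i.e. per left peak of `π⁻¹`.

What remains, for each alphabet, is the Goulden–Jackson cluster method on words. Expanding `s^occ =
((s - 1) + 1)^occ` turns the left side into the generating function `M` of marked words; the right
side is `∑ C^n`, where `C` counts nonempty words marked as clusters. Standardization is compatible
with passing to factors, so a nonempty marked word splits uniquely at its first cut into a cluster
and a marked word (`markedWordSum_eq`). Hence `(1 - C) M = 1`. -/

namespace ClusterMethod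

/-! ### Standardization of words with signed letters -/

/-- The sorting key of a letter `c` at position `i`: equal even letters are ordered by increasing
position, equal odd letters by decreasing position. -/
def letterKey (c i : ℕ) : ℕ ×ₗ ℤ :=
  toLex (c, if Even c then (i : ℤ) else -(i : ℤ))

theorem letterKey_lt_iff {c d i j : ℕ} :
    letterKey c i < letterKey d j ↔ c < d ∨ c = d ∧ if Even c then i < j else j < i := by
  unfold letterKey
  rw [Prod.Lex.toLex_lt_toLex]
  refine or_congr Iff.rfl (and_congr_right fun h => ?_)
  dsimp only at h
  subst h
  dsimp only
  split_ifs <;> simp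

/-- Ties depend only on relative positions; this makes the standardization of a suffix agree with
that of the whole word. -/
theorem letterKey_add_lt_iff {c d i j : ℕ} (a : ℕ) :
    letterKey c (a + i) < letterKey d (a + j) ↔ letterKey c i < letterKey d j := by
  simp only [letterKey_lt_iff, Nat.add_lt_add_iff_left]

theorem letterKey_injective_right {c d i j : ℕ} (h : letterKey c i = letterKey d j) : i = j := by
  unfold letterKey at h
  have h' := toLex.injective h
  rw [Prod.mk.injEq] at h'
  obtain ⟨rfl, h2⟩ := h'
  split_ifs at h2 <;> omega

/-- The sorting keys of the letters of a word. -/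
def wordKey {n K : ℕ} (w : Fin n → Fin K) (i : Fin n) : ℕ ×ₗ ℤ := letterKey (w i) i

theorem wordKey_injective {n K : ℕ} (w : Fin n → Fin K) : Function.Injective (wordKey w) :=
  fun _ _ h => Fin.ext (letterKey_injective_right h)

/-- The standardization of a word. -/
def standardize {n K : ℕ} (w : Fin n → Fin K) : Equiv.Perm (Fin n) := (Tuple.sort (wordKey w))⁻¹

theorem standardize_lt_iff {n K : ℕ} (w : Fin n → Fin K) (a b : Fin n) :
    standardize w a < standardize w b ↔ wordKey w a < wordKey w b := by
  have h : StrictMono (wordKey w ∘ Tuple.sort (wordKey w)) :=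
    (Tuple.monotone_sort _).strictMono_of_injective
      ((wordKey_injective w).comp (Equiv.injective _))
  rw [← h.lt_iff_lt]
  simp [standardize]

theorem perm_eq_of_lt_iff {n : ℕ} {π ρ : Equiv.Perm (Fin n)}
    (h : ∀ a b, π a < π b ↔ ρ a < ρ b) : π = ρ := by
  have key : StrictMono (ρ * π⁻¹ : Equiv.Perm (Fin n)) := by
    intro a b hab
    have := (h (π⁻¹ a) (π⁻¹ b)).1 (by simpa using hab)
    simpa using this
  have h1 : ∀ i, (ρ * π⁻¹ : Equiv.Perm (Fin n)) i = i := by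
    let e : Fin n ≃o Fin n := StrictMono.orderIsoOfSurjective _ key (Equiv.surjective _)
    intro i
    have : e = OrderIso.refl _ := Subsingleton.elim _ _
    exact congrArg (fun f : Fin n ≃o Fin n => f i) this
  ext i
  have := h1 (π i)
  have h2 : ρ i = π i := by simpa using this
  rw [h2]

theorem standardize_eq_iff {n K : ℕ} (w : Fin n → Fin K) (π : Equiv.Perm (Fin n)) :
    standardize w = π ↔ ∀ a b, π a < π b ↔ wordKey w a < wordKey w b := by
  constructor
  · rintro rfl
    exact standardize_lt_iff w
  · intro h
    exact perm_eq_of_lt_iff fun a b => (standardize_lt_iff w a b).trans (h a b).symm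

/-! ### Counting the words with a given standardization -/

/-- The relation between consecutive entries of a weakly increasing sequence whose even letters
may repeat at ascents (`¬ p`) and whose odd letters may repeat at descents (`p`). -/
def Step (p : Prop) (x y : ℕ) : Prop := x < y ∨ x = y ∧ (p ↔ Odd x)

/-- Position `i` is a descent, as a predicate on natural numbers. -/
def descentAt {n : ℕ} (τ : Equiv.Perm (Fin n)) (i : ℕ) : Prop :=
  ∃ h : i < n, IsDescent τ ⟨i, h⟩

/-- In order of rank under `π` the keys must increase strictly. A tie between neighbouring ranks is
settled by whether `π⁻¹` descends there. -/
theorem standardize_comp_eq_iff {n K : ℕ} (f : Fin (n + 1) → Fin K)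
    (π : Equiv.Perm (Fin (n + 1))) :
    standardize (f ∘ π) = π ↔
      ∀ i : Fin n, Step (descentAt π⁻¹ i) (f i.castSucc) (f i.succ) := by
  have h1 : standardize (f ∘ π) = π ↔
      StrictMono fun p : Fin (n + 1) => letterKey (f p) (π⁻¹ p : Fin (n + 1)) := by
    rw [standardize_eq_iff]
    constructor
    · intro h p q hpq
      have := (h (π⁻¹ p) (π⁻¹ q)).1 (by simpa using hpq)
      simpa [wordKey] using this
    · intro h a b
      rw [← h.lt_iff_lt]
      simp [wordKey]
  rw [h1, Fin.strictMono_iff_lt_succ]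
  refine forall_congr' fun i => ?_
  rw [letterKey_lt_iff, Step]
  refine or_congr Iff.rfl (and_congr_right fun _ => ?_)
  have hd : descentAt π⁻¹ i ↔ π⁻¹ i.succ < π⁻¹ i.castSucc := by
    constructor
    · rintro ⟨_, _, h⟩
      exact h
    · intro h
      exact ⟨by omega, by simp, h⟩
  have hne : π⁻¹ i.castSucc ≠ π⁻¹ i.succ := by
    intro h
    have := (π⁻¹).injective h
    simp [Fin.ext_iff] at this
  rw [hd, ← Nat.not_even_iff_odd]
  have hne' : ((π⁻¹ i.castSucc : Fin (n + 1)) : ℕ) ≠ (π⁻¹ i.succ : Fin (n + 1)) :=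
    fun h => hne (Fin.ext h)
  rw [Fin.lt_def]
  split_ifs with he
  · simp only [he, not_true, iff_false]; omega
  · simp only [he, not_false_iff, iff_true]

open Classical in
/-- The number of sequences of length `n + 1` following the descent pattern `d` and ending
in `m`. -/
noncomputable def lastCount (d : ℕ → Prop) : ℕ → ℕ → ℕ
  | 0, _ => 1
  | n + 1, m =>
    ∑ j ∈ Finset.range m, lastCount d n j + if (d n ↔ Odd m) then lastCount d n m else 0

open Classical in
theorem sum_step_fin (p : Prop) {K : ℕ} (m : Fin K) (g : ℕ → ℕ) :
    ∑ j : Fin K, (if Step p j m then g j else 0) =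
      ∑ j ∈ Finset.range m, g j + if (p ↔ Odd (m : ℕ)) then g m else 0 := by
  rw [Fin.sum_univ_eq_sum_range (fun j => if Step p j m then g j else 0) K]
  rw [← Finset.sum_subset (s₁ := Finset.range (m + 1))]
  · rw [Finset.sum_range_succ]
    congr 1
    · refine Finset.sum_congr rfl fun j hj => ?_
      rw [if_pos (show Step p j m from Or.inl (Finset.mem_range.1 hj))]
    · simp [Step]
  · intro j hj
    have := m.isLt
    simp at hj ⊢
    omega
  · intro j _ hj
    have : m < j := by simpa using hj
    rw [if_neg]
    unfold Step
    omega

open Classical in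
-- Peel off the last entry. The alphabet size drops out because the sequence is weakly increasing,
-- hence bounded by its last entry.
theorem card_steps_last (d : ℕ → Prop) (K n : ℕ) (m : Fin K) :
    (Finset.univ.filter fun f : Fin (n + 1) → Fin K =>
      (∀ i : Fin n, Step (d i) (f i.castSucc) (f i.succ)) ∧ f (Fin.last n) = m).card =
    lastCount d n m := by
  induction n generalizing m with
  | zero =>
    rw [lastCount, Finset.card_eq_one]
    refine ⟨fun _ => m, ?_⟩
    ext f
    simp only [Finset.mem_filter, Finset.mem_univ, true_and, Finset.mem_singleton]
    constructor
    · rintro ⟨-, h⟩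
      funext i
      rw [show i = Fin.last 0 from Fin.ext (by omega), h]
    · rintro rfl
      exact ⟨fun i => i.elim0, rfl⟩
  | succ n ih =>
    rw [lastCount, ← sum_step_fin (d n) m, Finset.card_filter,
      ← (Fin.snocEquiv fun _ : Fin (n + 1 + 1) => Fin K).sum_comp, Fintype.sum_prod_type]
    rw [Finset.sum_eq_single m]
    · rw [← Finset.card_filter]
      rw [Finset.card_eq_sum_card_fiberwise (t := Finset.univ) (f := fun g => g (Fin.last n))
        (fun _ _ => Finset.mem_coe.2 (Finset.mem_univ _))]
      refine Finset.sum_congr rfl fun j _ => ?_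
      rw [← ih, Finset.filter_filter]
      split_ifs with hs
      · congr 1
        ext g
        simp only [Finset.mem_filter, Finset.mem_univ, true_and]
        simp only [Fin.snocEquiv_apply, Fin.snoc_last, and_true]
        rw [Fin.forall_fin_succ']
        simp only [← Fin.castSucc_succ, Fin.snoc_castSucc, Fin.succ_last, Fin.snoc_last]
        constructor
        · rintro ⟨⟨h1, -⟩, h2⟩
          exact ⟨h1, h2⟩
        · rintro ⟨h1, rfl⟩
          exact ⟨⟨h1, by simpa using hs⟩, rfl⟩
      · rw [Finset.card_eq_zero]
        ext g
        simp only [Finset.mem_filter, Finset.mem_univ, true_and, Finset.notMem_empty, iff_false]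
        simp only [Fin.snocEquiv_apply, Fin.snoc_last, and_true]
        rw [Fin.forall_fin_succ']
        simp only [← Fin.castSucc_succ, Fin.snoc_castSucc, Fin.succ_last, Fin.snoc_last]
        rintro ⟨⟨-, h1⟩, rfl⟩
        exact hs (by simpa using h1)
    · intro b _ hb
      refine Finset.sum_eq_zero fun g _ => ?_
      rw [if_neg]
      simp [Fin.snocEquiv_apply, hb]
    · simp

theorem card_standardize_eq {n : ℕ} (K : ℕ) (π : Equiv.Perm (Fin (n + 1))) :
    (Finset.univ.filter fun w : Fin (n + 1) → Fin K => standardize w = π).card =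
      ∑ m ∈ Finset.range K, lastCount (descentAt π⁻¹) n m := by
  classical
  rw [← Fin.sum_univ_eq_sum_range]
  simp_rw [← card_steps_last]
  -- Every word is `f ∘ π` for a unique `f`, namely the word read in order of rank under `π`.
  rw [Finset.card_filter, ← (π.symm.arrowCongr (Equiv.refl (Fin K))).sum_comp,
    ← Finset.card_filter]
  rw [Finset.card_eq_sum_card_fiberwise (t := Finset.univ) (f := fun g => g (Fin.last n))
        (fun _ _ => Finset.mem_coe.2 (Finset.mem_univ _))]
  refine Finset.sum_congr rfl fun j _ => ?_
  rw [Finset.filter_filter]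
  congr 1
  ext f
  simp only [Finset.mem_filter, Finset.mem_univ, true_and]
  rw [← standardize_comp_eq_iff]
  rfl

/-! ### The generating function of the word counts -/

/-- The generating function of the sequences of length `n + 1` ending in an even letter. -/
noncomputable def evenSeries (d : ℕ → Prop) (n : ℕ) : Ser :=
  PowerSeries.mk fun k => (lastCount d n (2 * k) : PowerSeries (Polynomial ℚ))

/-- The generating function of the sequences of length `n + 1` ending in an odd letter. -/
noncomputable def oddSeries (d : ℕ → Prop) (n : ℕ) : Ser :=
  PowerSeries.mk fun k => (lastCount d n (2 * k + 1) : PowerSeries (Polynomial ℚ))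

/-- The generating function of all sequences of length `n + 1`, by alphabet size. -/
noncomputable def totalSeries (d : ℕ → Prop) (n : ℕ) : Ser :=
  PowerSeries.mk fun k =>
    ((∑ m ∈ Finset.range (2 * k + 1), lastCount d n m : ℕ) : PowerSeries (Polynomial ℚ))

/-- Passing from `2k + 1` to `2k + 3` letters adds the possible last letters `2k + 1` and `2k + 2`.
-/
theorem one_sub_mul_totalSeries (d : ℕ → Prop) (n : ℕ) :
    (1 - tVar) * totalSeries d n = evenSeries d n + tVar * oddSeries d n := by
  ext1 k
  rw [sub_mul, one_mul]
  cases k with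
  | zero => simp [tVar, totalSeries, evenSeries]
  | succ k =>
    simp only [tVar, totalSeries, evenSeries, oddSeries, map_sub, map_add,
      PowerSeries.coeff_succ_X_mul, PowerSeries.coeff_mk]
    rw [show 2 * (k + 1) + 1 = 2 * k + 1 + 1 + 1 by ring, Finset.sum_range_succ,
      Finset.sum_range_succ, show 2 * (k + 1) = 2 * k + 1 + 1 by ring]
    push_cast
    ring

theorem evenSeries_succ_of_not {d : ℕ → Prop} {n : ℕ} (h : ¬ d n) :
    evenSeries d (n + 1) = totalSeries d n := by
  ext1 k
  simp only [evenSeries, totalSeries, PowerSeries.coeff_mk]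
  rw [lastCount, if_pos (by simp [h]), Finset.sum_range_succ]

theorem oddSeries_succ_of_not {d : ℕ → Prop} {n : ℕ} (h : ¬ d n) :
    oddSeries d (n + 1) = totalSeries d n := by
  ext1 k
  simp only [oddSeries, totalSeries, PowerSeries.coeff_mk]
  rw [lastCount, if_neg (by simp [h]), add_zero]

theorem evenSeries_succ_of_pos {d : ℕ → Prop} {n : ℕ} (h : d n) :
    evenSeries d (n + 1) = totalSeries d n - evenSeries d n := by
  ext1 k
  simp only [evenSeries, totalSeries, PowerSeries.coeff_mk, map_sub]
  rw [lastCount, if_neg (by simp [h]), Finset.sum_range_succ]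
  push_cast
  ring

theorem oddSeries_succ_of_pos {d : ℕ → Prop} {n : ℕ} (h : d n) :
    oddSeries d (n + 1) = totalSeries d n + oddSeries d n := by
  ext1 k
  simp only [oddSeries, totalSeries, PowerSeries.coeff_mk, map_add]
  rw [lastCount, if_pos (by simp [h])]
  push_cast
  ring

open Classical in
/-- The number of indices below `n` at which a run of `d` starts. -/
noncomputable def runCount (d : ℕ → Prop) (n : ℕ) : ℕ :=
  ((Finset.range n).filter fun i => d i ∧ (i = 0 ∨ ¬ d (i - 1))).card

theorem runCount_succ_of_pos {d : ℕ → Prop} {n : ℕ} (h : d n ∧ (n = 0 ∨ ¬ d (n - 1))) :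
    runCount d (n + 1) = runCount d n + 1 := by
  rw [runCount, runCount, Finset.range_add_one, Finset.filter_insert, if_pos h,
    Finset.card_insert_of_notMem (by simp)]

theorem runCount_succ_of_not {d : ℕ → Prop} {n : ℕ} (h : ¬ (d n ∧ (n = 0 ∨ ¬ d (n - 1)))) :
    runCount d (n + 1) = runCount d n := by
  rw [runCount, runCount, Finset.range_add_one, Finset.filter_insert, if_neg h]

/-- Write `E`, `O` for the two series. After a descent `E = tO`, otherwise `O = E`, so `E + tO`
determines both. Each step multiplies it by `(1 + t)/(1 - t)`, except at the start of a run, where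
the factor is `(1 + t)/(1 - t) - (1 - t)/(1 + t) = u (1 + t)/(1 - t)`. -/
theorem evenSeries_add_oddSeries (d : ℕ → Prop) (n : ℕ) :
    ((n ≠ 0 ∧ d (n - 1) → evenSeries d n = tVar * oddSeries d n) ∧
      (¬ (n ≠ 0 ∧ d (n - 1)) → oddSeries d n = evenSeries d n)) ∧
    evenSeries d n + tVar * oddSeries d n =
      ((1 + tVar) * invOneSub) ^ (n + 1) * uSer ^ runCount d n := by
  induction n with
  | zero =>
    have hE : evenSeries d 0 = invOneSub := by
      have h : (1 - tVar) * evenSeries d 0 = 1 := by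
        ext1 k
        rw [sub_mul, one_mul]
        cases k with
        | zero => simp [tVar, evenSeries, lastCount]
        | succ k => simp [tVar, evenSeries, lastCount, PowerSeries.coeff_succ_X_mul,
            PowerSeries.coeff_one]
      linear_combination invOneSub * h - evenSeries d 0 * one_sub_mul_invOneSub
    have hO : oddSeries d 0 = evenSeries d 0 := by
      ext1 k
      simp [evenSeries, oddSeries, lastCount]
    refine ⟨⟨fun h => absurd rfl h.1, fun _ => hO⟩, ?_⟩
    rw [hO, hE]
    simp [runCount]
    ring
  | succ n ih =>
    obtain ⟨⟨ih1, ih2⟩, ih⟩ := ih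
    have hV := one_sub_mul_totalSeries d n
    have hV' : totalSeries d n = invOneSub * (evenSeries d n + tVar * oddSeries d n) := by
      linear_combination invOneSub * hV - totalSeries d n * one_sub_mul_invOneSub
    rw [Nat.add_sub_cancel]
    by_cases h : d n
    · rw [evenSeries_succ_of_pos h, oddSeries_succ_of_pos h]
      by_cases hs : n ≠ 0 ∧ d (n - 1)
      · rw [runCount_succ_of_not (by tauto)]
        refine ⟨⟨fun _ => ?_, fun h' => absurd ⟨n.succ_ne_zero, h⟩ h'⟩, ?_⟩
        · linear_combination hV
        · rw [pow_succ, mul_right_comm, ← ih, hV']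
          linear_combination -ih1 hs
      · rw [runCount_succ_of_pos ⟨h, by tauto⟩]
        refine ⟨⟨fun _ => ?_, fun h' => absurd ⟨n.succ_ne_zero, h⟩ h'⟩, ?_⟩
        · linear_combination hV
        · rw [pow_succ _ (n + 1), pow_succ _ (runCount d n), mul_mul_mul_comm, ← ih, hV', ih2 hs, uSer]
          have h1 := one_sub_mul_invOneSub
          have h2 : ((1 + tVar) * invOneAdd) ^ 2 = 1 := by rw [one_add_mul_invOneAdd, one_pow]
          linear_combination (1 - tVar) * evenSeries d n * h1
            - 4 * tVar * invOneSub * evenSeries d n * h2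
    · rw [evenSeries_succ_of_not h, oddSeries_succ_of_not h, runCount_succ_of_not (by tauto)]
      refine ⟨⟨fun h' => absurd h'.2 h, fun _ => rfl⟩, ?_⟩
      rw [pow_succ, mul_right_comm, ← ih, hV']
      ring

theorem totalSeries_eq (d : ℕ → Prop) (n : ℕ) :
    totalSeries d n = invOneSub * (((1 + tVar) * invOneSub) ^ (n + 1) * uSer ^ runCount d n) := by
  rw [← (evenSeries_add_oddSeries d n).2]
  linear_combination invOneSub * one_sub_mul_totalSeries d n
    - totalSeries d n * one_sub_mul_invOneSub

/-- Left peaks are the first positions of the maximal runs of descents. -/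
theorem lpk_eq_runCount {n : ℕ} (τ : Equiv.Perm (Fin (n + 1))) :
    lpk τ = runCount (descentAt τ) n := by
  classical
  rw [lpk, runCount]
  refine Finset.card_bij (fun i _ => (i : ℕ)) ?_ (fun _ _ _ _ h => Fin.ext h) ?_
  · intro i hi
    have hi := (Finset.mem_filter.1 hi).2
    rw [Finset.mem_filter, Finset.mem_range]
    rcases hi with ⟨h0, h1, h2⟩ | ⟨h0, h2⟩
    · refine ⟨by have := h2.1; omega, ⟨i.isLt, h2⟩, Or.inr ?_⟩
      rintro ⟨_, _, h3⟩
      simp only [Nat.sub_add_cancel h0] at h3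
      exact lt_asymm h1 h3
    · exact ⟨by have := h2.1; omega, ⟨i.isLt, h2⟩, Or.inl h0⟩
  · intro i hi
    rw [Finset.mem_filter, Finset.mem_range] at hi
    obtain ⟨hin, ⟨hlt, h2⟩, h⟩ := hi
    refine ⟨⟨i, hlt⟩, Finset.mem_filter.2 ⟨Finset.mem_univ _, ?_⟩, rfl⟩
    rcases Nat.eq_zero_or_pos i with h0 | h0
    · exact Or.inr ⟨h0, h2⟩
    · refine Or.inl ⟨h0, ?_, h2⟩
      have h' := h.resolve_left h0.ne'
      by_contra h4
      refine h' ⟨by omega, by simp only; omega, ?_⟩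
      simp only [Nat.sub_add_cancel h0]
      refine lt_of_le_of_ne (not_lt.1 h4) fun h5 => ?_
      have := congrArg Fin.val (τ.injective h5)
      simp only at this
      omega

theorem zSer_pow (n : ℕ) : zSer ^ n = xVar ^ n * ((1 + tVar) * invOneSub) ^ n := by
  rw [zSer, ← mul_pow]
  ring

theorem invOneSub_eq : invOneSub = PowerSeries.mk fun _ => (1 : PowerSeries (Polynomial ℚ)) := by
  have h : (1 - tVar) * (PowerSeries.mk fun _ => (1 : PowerSeries (Polynomial ℚ))) = 1 := by
    rw [mul_comm]
    exact PowerSeries.mk_one_mul_one_sub_eq_one _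
  linear_combination invOneSub * (- h)
    + (PowerSeries.mk fun _ => (1 : PowerSeries (Polynomial ℚ))) * one_sub_mul_invOneSub

theorem coeff_xVar_pow_mul (i n : ℕ) (f : Ser) :
    PowerSeries.coeff i (xVar ^ n * f) = PowerSeries.X ^ n * PowerSeries.coeff i f := by
  rw [xVar, ← map_pow, PowerSeries.coeff_C_mul]

/-- The words over `2k + 1` letters that standardize to `π` are counted by the coefficient of
`t^k` in `u^{ilpk π} z^n / (1 - t)`. -/
theorem coeff_invOneSub_mul_pow_ilpk {n : ℕ} (π : Equiv.Perm (Fin n)) (k : ℕ) :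
    PowerSeries.coeff k (invOneSub * (uSer ^ ilpk π * zSer ^ n)) =
      PowerSeries.X ^ n * ((Finset.univ.filter fun w : Fin n → Fin (2 * k + 1) =>
        standardize w = π).card : PowerSeries (Polynomial ℚ)) := by
  rw [zSer_pow, show invOneSub * (uSer ^ ilpk π * (xVar ^ n * ((1 + tVar) * invOneSub) ^ n)) =
    xVar ^ n * (invOneSub * (((1 + tVar) * invOneSub) ^ n * uSer ^ ilpk π)) by ring,
    coeff_xVar_pow_mul]
  congr 1
  cases n with
  | zero =>
    have h1 : ilpk π = 0 := by simp [ilpk, lpk]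
    have h2 : ∀ w : Fin 0 → Fin (2 * k + 1), standardize w = π := fun w => Subsingleton.elim _ _
    simp [h1, h2, invOneSub_eq]
  | succ n =>
    rw [ilpk, lpk_eq_runCount, ← totalSeries_eq, totalSeries, PowerSeries.coeff_mk,
      card_standardize_eq]

/-! ### Splitting sets of intervals at the first cut -/

/-- `p` is a positive cut point of the intervals `[lo o, hi o)` for `o ∈ T`. -/
def IsCut {α : Type*} (lo hi : α → ℕ) (T : Finset α) (p : ℕ) : Prop :=
  0 < p ∧ ∀ o ∈ T, hi o ≤ p ∨ p ≤ lo o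

open Classical in
-- Since `n` is always a cut, there is a least cut `a`. No interval straddles it, so the set splits
-- into the intervals ending by `a` and those starting from `a`; an earlier cut of the first part
-- would be one of the whole set.
theorem sum_powerset_pow_card_firstCut {α A : Type*} [CommSemiring A] (lo hi : α → ℕ)
    (S : Finset α) {n : ℕ} (hn : 0 < n) (hS : ∀ o ∈ S, lo o < hi o ∧ hi o ≤ n) (y : A) :
    ∑ T ∈ S.powerset, y ^ T.card = ∑ a ∈ Finset.Icc 1 n,
      (∑ T ∈ (S.filter fun o => hi o ≤ a).powerset.filter (fun T => ∀ p < a, ¬ IsCut lo hi T p),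
        y ^ T.card) *
      ∑ T ∈ (S.filter fun o => a ≤ lo o).powerset, y ^ T.card := by
  have hcut : ∀ T ∈ S.powerset, IsCut lo hi T n := fun T hT =>
    ⟨hn, fun o ho => Or.inl (hS o (Finset.mem_powerset.1 hT ho)).2⟩
  have hmem : ∀ T ∈ S.powerset, IsCut lo hi T (sInf {p | IsCut lo hi T p}) := fun T hT =>
    Nat.sInf_mem (s := {p | IsCut lo hi T p}) ⟨n, hcut T hT⟩
  rw [← Finset.sum_fiberwise_of_maps_to (s := S.powerset) (t := Finset.Icc 1 n)
    (g := fun T => sInf {p | IsCut lo hi T p})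
    (fun T hT => Finset.mem_Icc.2 ⟨(hmem T hT).1, Nat.sInf_le (hcut T hT)⟩)]
  refine Finset.sum_congr rfl fun a ha => ?_
  have ha := (Finset.mem_Icc.1 ha).1
  rw [Finset.sum_mul_sum, ← Finset.sum_product']
  refine Finset.sum_nbij' (fun T => (T.filter fun o => hi o ≤ a, T.filter fun o => a ≤ lo o))
    (fun q => q.1 ∪ q.2) ?_ ?_ ?_ ?_ ?_
  · intro T hT
    rw [Finset.mem_filter] at hT
    obtain ⟨hT, rfl⟩ := hT
    have hc := hmem T hT
    have hT' := Finset.mem_powerset.1 hT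
    rw [Finset.mem_product, Finset.mem_filter, Finset.mem_powerset, Finset.mem_powerset]
    refine ⟨⟨Finset.filter_subset_filter _ hT', fun p hp hpc => ?_⟩,
      Finset.filter_subset_filter _ hT'⟩
    refine Nat.notMem_of_lt_sInf hp ⟨hpc.1, fun o ho => ?_⟩
    rcases hc.2 o ho with h | h
    · exact hpc.2 o (Finset.mem_filter.2 ⟨ho, h⟩)
    · exact Or.inr (hp.le.trans h)
  · rintro ⟨T₁, T₂⟩ hT
    rw [Finset.mem_product, Finset.mem_filter, Finset.mem_powerset, Finset.mem_powerset] at hT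
    obtain ⟨⟨h1, h2⟩, h3⟩ := hT
    dsimp only at h1 h2 h3 ⊢
    have hT : T₁ ∪ T₂ ∈ S.powerset := Finset.mem_powerset.2
      (Finset.union_subset (h1.trans (Finset.filter_subset _ _))
        (h3.trans (Finset.filter_subset _ _)))
    rw [Finset.mem_filter]
    refine ⟨hT, le_antisymm (Nat.sInf_le ⟨ha, fun o ho => ?_⟩) ?_⟩
    · rcases Finset.mem_union.1 ho with h | h
      · exact Or.inl (Finset.mem_filter.1 (h1 h)).2
      · exact Or.inr (Finset.mem_filter.1 (h3 h)).2
    · by_contra hlt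
      refine h2 _ (not_le.1 hlt) ⟨(hmem _ hT).1, fun o ho => ?_⟩
      exact (hmem _ hT).2 o (Finset.mem_union_left _ ho)
  · intro T hT
    rw [Finset.mem_filter] at hT
    obtain ⟨hT, rfl⟩ := hT
    rw [← Finset.filter_or]
    exact Finset.filter_true_of_mem (hmem T hT).2
  · rintro ⟨T₁, T₂⟩ hT
    rw [Finset.mem_product, Finset.mem_filter, Finset.mem_powerset, Finset.mem_powerset] at hT
    obtain ⟨⟨h1, -⟩, h3⟩ := hT
    dsimp only at h1 h3 ⊢
    have e1 : ∀ o ∈ T₁, lo o < hi o ∧ hi o ≤ a := fun o ho =>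
      ⟨(hS o (Finset.mem_filter.1 (h1 ho)).1).1, (Finset.mem_filter.1 (h1 ho)).2⟩
    have e2 : ∀ o ∈ T₂, lo o < hi o ∧ a ≤ lo o := fun o ho =>
      ⟨(hS o (Finset.mem_filter.1 (h3 ho)).1).1, (Finset.mem_filter.1 (h3 ho)).2⟩
    rw [Finset.filter_union, Finset.filter_union]
    rw [Finset.filter_true_of_mem fun o ho => (e1 o ho).2,
      Finset.filter_true_of_mem fun o ho => (e2 o ho).2,
      Finset.filter_false_of_mem fun o ho => by have := e2 o ho; omega,
      Finset.filter_false_of_mem fun o ho => by have := e1 o ho; omega,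
      Finset.union_empty, Finset.empty_union]
  · intro T hT
    rw [Finset.mem_filter] at hT
    obtain ⟨hT, rfl⟩ := hT
    rw [← pow_add, ← Finset.card_union_of_disjoint, ← Finset.filter_or,
      Finset.filter_true_of_mem (hmem T hT).2]
    refine Finset.disjoint_filter.2 fun o ho h => ?_
    have := hS o (Finset.mem_powerset.1 hT ho)
    omega

/-! ### Occurrences in words and in their factors -/

/-- The position after the end of an occurrence. -/
def occEnd (o : ℕ × AllPerm) : ℕ := o.1 + o.2.1

theorem mem_occurrences {Γ : Set AllPerm} {n : ℕ} {π : Equiv.Perm (Fin n)} {o : ℕ × AllPerm} :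
    o ∈ occurrences Γ π ↔ o.2 ∈ Γ ∧ IsOccAt o.2.2 π o.1 := by
  rw [occurrences, Set.Finite.mem_toFinset]
  rfl

theorem occEnd_le {Γ : Set AllPerm} {n : ℕ} {π : Equiv.Perm (Fin n)} {o : ℕ × AllPerm}
    (h : o ∈ occurrences Γ π) : occEnd o ≤ n :=
  (mem_occurrences.1 h).2.1

theorem lt_occEnd {Γ : Set AllPerm} (hΓ : ∀ σ ∈ Γ, 2 ≤ σ.1) {n : ℕ} {π : Equiv.Perm (Fin n)}
    {o : ℕ × AllPerm} (h : o ∈ occurrences Γ π) : o.1 < occEnd o := by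
  have := hΓ _ (mem_occurrences.1 h).1
  rw [occEnd]
  omega

theorem isOccAt_standardize {m n K i : ℕ} (σ : Equiv.Perm (Fin m)) (w : Fin n → Fin K) :
    IsOccAt σ (standardize w) i ↔ ∃ h : i + m ≤ n, ∀ a b : Fin m, σ a < σ b ↔
      letterKey (w ⟨i + a, by omega⟩) (i + a) < letterKey (w ⟨i + b, by omega⟩) (i + b) := by
  simp only [IsOccAt, standardize_lt_iff, wordKey]

theorem isOccAt_standardize_left {m a b K i : ℕ} (σ : Equiv.Perm (Fin m)) (w : Fin (a + b) → Fin K)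
    (h : i + m ≤ a) : IsOccAt σ (standardize fun j => w (Fin.castAdd b j)) i ↔
      IsOccAt σ (standardize w) i := by
  rw [isOccAt_standardize, isOccAt_standardize, exists_prop_of_true h,
    exists_prop_of_true (show i + m ≤ a + b by omega)]
  rfl

theorem isOccAt_standardize_right {m a b K i : ℕ} (σ : Equiv.Perm (Fin m))
    (w : Fin (a + b) → Fin K) :
    IsOccAt σ (standardize fun j => w (Fin.natAdd a j)) i ↔
      IsOccAt σ (standardize w) (a + i) := by
  rw [isOccAt_standardize, isOccAt_standardize]
  by_cases h : i + m ≤ b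
  swap
  · exact ⟨fun h' => absurd h'.1 h, fun h' => absurd h'.1 (by omega)⟩
  rw [exists_prop_of_true h, exists_prop_of_true (show a + i + m ≤ a + b by omega)]
  refine forall_congr' fun p => forall_congr' fun q => ?_
  simp only [Nat.add_assoc, letterKey_add_lt_iff]
  rfl

theorem isOccAt_self {n : ℕ} (π : Equiv.Perm (Fin n)) : IsOccAt π π 0 :=
  ⟨by omega, by simp⟩

open Classical in
theorem occurrences_left (Γ : Set AllPerm) {a b K : ℕ} (w : Fin (a + b) → Fin K) :
    occurrences Γ (standardize fun j => w (Fin.castAdd b j)) =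
      (occurrences Γ (standardize w)).filter fun o => occEnd o ≤ a := by
  ext o
  rw [Finset.mem_filter]
  by_cases h : occEnd o ≤ a
  · rw [mem_occurrences, mem_occurrences, isOccAt_standardize_left _ _ h]
    simp [h]
  · simp only [h, and_false, iff_false]
    exact fun h' => h (occEnd_le h')

/-- Shifting an occurrence by `a` positions. -/
def occShift (a : ℕ) : ℕ × AllPerm ↪ ℕ × AllPerm :=
  ⟨fun o => (a + o.1, o.2), fun o o' h => by
    simp only [Prod.mk.injEq, Nat.add_left_cancel_iff] at h
    exact Prod.ext h.1 h.2⟩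

theorem occShift_mem_occurrences (Γ : Set AllPerm) {a b K : ℕ} (w : Fin (a + b) → Fin K)
    (o : ℕ × AllPerm) : occShift a o ∈ occurrences Γ (standardize w) ↔
      o ∈ occurrences Γ (standardize fun j => w (Fin.natAdd a j)) := by
  rw [mem_occurrences, mem_occurrences, isOccAt_standardize_right]
  rfl

theorem exists_occShift {a : ℕ} {o : ℕ × AllPerm} (h : a ≤ o.1) : ∃ o', occShift a o' = o :=
  ⟨(o.1 - a, o.2), Prod.ext (Nat.add_sub_of_le h) rfl⟩

open Classical in
theorem map_occShift_occurrences (Γ : Set AllPerm) {a b K : ℕ} (w : Fin (a + b) → Fin K) :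
    (occurrences Γ (standardize fun j => w (Fin.natAdd a j))).map (occShift a) =
      (occurrences Γ (standardize w)).filter fun o => a ≤ o.1 := by
  ext o
  rw [Finset.mem_filter, Finset.mem_map]
  constructor
  · rintro ⟨o', h, rfl⟩
    exact ⟨(occShift_mem_occurrences Γ w o').2 h, Nat.le_add_right _ _⟩
  · rintro ⟨h, ha⟩
    obtain ⟨o', rfl⟩ := exists_occShift ha
    exact ⟨o', (occShift_mem_occurrences Γ w o').1 h, rfl⟩

/-! ### Clusters have no inner cuts -/

/-- At a cut the marking restricts to prefix and suffix; conversely, the junction of a concatenation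
is a cut. -/
theorem isCluster_standardize_iff (Γ : Set AllPerm) {n K : ℕ} (w : Fin n → Fin K)
    (T : Finset (ℕ × AllPerm)) : IsCluster Γ (standardize w) T ↔
      T ⊆ occurrences Γ (standardize w) ∧ ∀ p < n, ¬ IsCut Prod.fst occEnd T p := by
  classical
  refine and_congr_right fun hT => ⟨fun h p hp hcut => h ?_, ?_⟩
  · obtain ⟨b, rfl⟩ := Nat.exists_eq_add_of_lt hp
    change Fin (p + (b + 1)) → Fin K at w
    refine ⟨p, b + 1, standardize fun j => w (Fin.castAdd (b + 1) j), T.filter fun o => occEnd o ≤ p,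
      standardize fun j => w (Fin.natAdd p j),
      (occurrences Γ (standardize fun j => w (Fin.natAdd p j))).filter fun o => occShift p o ∈ T,
      hcut.1, Nat.succ_pos b, ?_, Finset.filter_subset _ _, rfl, ?_, ?_, fun o => ⟨fun ho => ?_, ?_⟩⟩
    · rw [IsMarked, occurrences_left]
      exact Finset.filter_subset_filter _ hT
    · exact (isOccAt_standardize_left _ w (by omega)).1 (isOccAt_self _)
    · exact (isOccAt_standardize_right (i := 0) _ w).1 (isOccAt_self _)
    · rcases hcut.2 o ho with h | h
      · exact Or.inl (Finset.mem_filter.2 ⟨ho, h⟩)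
      · obtain ⟨o', rfl⟩ := exists_occShift h
        exact Or.inr ⟨o', Finset.mem_filter.2
          ⟨(occShift_mem_occurrences Γ w o').1 (hT ho), ho⟩, rfl⟩
    · rintro (h | ⟨v, hv, rfl⟩)
      · exact (Finset.mem_filter.1 h).1
      · exact (Finset.mem_filter.1 hv).2
  · rintro h ⟨a, b, α, U, β, V, ha, hb, hU, hV, hn, -, -, hTUV⟩
    refine h a (by omega) ⟨ha, fun o ho => ?_⟩
    rcases (hTUV o).1 ho with h | ⟨v, -, rfl⟩
    · exact Or.inl (occEnd_le (hU h))
    · exact Or.inr (Nat.le_add_right _ _)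

/-! ### Marked words -/

/-- The generating function of the clusters on words of length `n`. -/
noncomputable def clusterWordSum {A : Type*} [CommSemiring A] (Γ : Set AllPerm) (y : A)
    (K n : ℕ) : A :=
  ∑ w : Fin n → Fin K, ∑ c ∈ clusters Γ (standardize w), y ^ c.card

/-- The generating function of the marked words of length `n`. -/
noncomputable def markedWordSum {A : Type*} [CommSemiring A] (Γ : Set AllPerm) (y : A)
    (K n : ℕ) : A :=
  ∑ w : Fin n → Fin K, ∑ T ∈ (occurrences Γ (standardize w)).powerset, y ^ T.card

/-- A nonempty marked word is uniquely a cluster followed by a marked word. -/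
theorem markedWordSum_eq {A : Type*} [CommSemiring A] {Γ : Set AllPerm}
    (hΓ : ∀ σ ∈ Γ, 2 ≤ σ.1) (y : A) (K : ℕ) {n : ℕ} (hn : 0 < n) :
    markedWordSum Γ y K n =
      ∑ a ∈ Finset.Icc 1 n, clusterWordSum Γ y K a * markedWordSum Γ y K (n - a) := by
  classical
  rw [markedWordSum, Finset.sum_congr rfl fun w _ => sum_powerset_pow_card_firstCut Prod.fst occEnd
    (occurrences Γ (standardize w)) hn (fun o ho => ⟨lt_occEnd hΓ ho, occEnd_le ho⟩) y,
    Finset.sum_comm]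
  refine Finset.sum_congr rfl fun a ha => ?_
  obtain ⟨b, rfl⟩ := Nat.exists_eq_add_of_le (Finset.mem_Icc.1 ha).2
  -- A word of length `a + b` is a prefix and a suffix. Marks ending by `a` depend only on the
  -- prefix, those starting from `a` only on the suffix, so the sum factors.
  rw [Nat.add_sub_cancel_left, clusterWordSum, markedWordSum, Finset.sum_mul_sum,
    ← Finset.sum_product', ← Finset.univ_product_univ.symm, ← (Fin.appendEquiv a b).sum_comp]
  refine Finset.sum_congr rfl fun q _ => ?_
  have h1 : (fun j => Fin.appendEquiv a b q (Fin.castAdd b j)) = q.1 := by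
    funext j
    simp [Fin.appendEquiv]
  have h2 : (fun j => Fin.appendEquiv a b q (Fin.natAdd a j)) = q.2 := by
    funext j
    simp [Fin.appendEquiv]
  congr 1
  · rw [← occurrences_left, h1]
    refine Finset.sum_congr ?_ fun _ _ => rfl
    ext T
    simp only [clusters, Finset.mem_filter, Finset.mem_powerset, isCluster_standardize_iff]
    tauto
  · rw [← map_occShift_occurrences, h2]
    refine (Finset.sum_nbij (fun T => T.map (occShift a)) ?_ ?_ ?_ ?_).symm
    · intro T hT
      rw [Finset.mem_powerset] at hT ⊢
      exact Finset.map_subset_map.2 hT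
    · exact fun _ _ _ _ h => Finset.map_injective _ h
    · intro T hT
      obtain ⟨T', hT', rfl⟩ := Finset.subset_map_iff.1 (Finset.mem_powerset.1 hT)
      exact ⟨T', Finset.mem_powerset.2 hT', rfl⟩
    · intro T _
      rw [Finset.card_map]

/-- Each occurrence is either marked, with weight `y`, or unmarked, with weight `1`. -/
theorem markedWordSum_eq_sum_pow_occ {A : Type*} [CommSemiring A] (Γ : Set AllPerm) (y : A)
    (K n : ℕ) :
    markedWordSum Γ y K n = ∑ w : Fin n → Fin K, (y + 1) ^ occ Γ (standardize w) := by
  refine Finset.sum_congr rfl fun w _ => ?_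
  rw [occ, ← Finset.sum_pow_mul_eq_add_pow]
  simp

theorem occurrences_eq_empty {Γ : Set AllPerm} (hΓ : ∀ σ ∈ Γ, 2 ≤ σ.1) {n : ℕ} (hn : n < 2)
    (π : Equiv.Perm (Fin n)) : occurrences Γ π = ∅ := by
  refine Finset.eq_empty_of_forall_notMem fun o ho => ?_
  have h1 := hΓ _ (mem_occurrences.1 ho).1
  have h2 := occEnd_le ho
  rw [occEnd] at h2
  omega

theorem markedWordSum_zero {A : Type*} [CommSemiring A] {Γ : Set AllPerm}
    (hΓ : ∀ σ ∈ Γ, 2 ≤ σ.1) (y : A) (K : ℕ) : markedWordSum Γ y K 0 = 1 := by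
  simp [markedWordSum, occurrences_eq_empty hΓ]

/-! ### Formal sums -/

theorem coeff_coeff_eq_zero_of_xVar_pow_dvd {f : Ser} {n : ℕ} (h : xVar ^ n ∣ f) {i j : ℕ}
    (hj : j < n) : PowerSeries.coeff j (PowerSeries.coeff i f) = 0 := by
  obtain ⟨g, rfl⟩ := h
  rw [coeff_xVar_pow_mul, PowerSeries.coeff_X_pow_mul', if_neg (by omega)]

theorem formallySummable_of_xVar_pow_dvd {f : ℕ → Ser} (h : ∀ n, xVar ^ n ∣ f n) :
    FormallySummable f := fun i j =>
  (Set.finite_le_nat j).subset fun n hn => by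
    by_contra hlt
    exact hn (coeff_coeff_eq_zero_of_xVar_pow_dvd (h n) (not_le.1 hlt))

/-- Divisibility by `x^n` leaves only the terms with `n ≤ j`. -/
theorem coeff_coeff_formalSum {f : ℕ → Ser} (h : ∀ n, xVar ^ n ∣ f n) (i j : ℕ) :
    PowerSeries.coeff j (PowerSeries.coeff i (formalSum f)) =
      ∑ n ∈ Finset.range (j + 1), PowerSeries.coeff j (PowerSeries.coeff i (f n)) := by
  rw [formalSum, PowerSeries.coeff_mk, PowerSeries.coeff_mk]
  refine finsum_eq_sum_of_support_subset _ fun n hn => ?_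
  rw [Finset.mem_coe, Finset.mem_range]
  by_contra hlt
  exact hn (coeff_coeff_eq_zero_of_xVar_pow_dvd (h n) (by omega))

theorem coeff_invOneSub_mul (i : ℕ) (f : Ser) :
    PowerSeries.coeff i (invOneSub * f) =
      ∑ k ∈ Finset.range (i + 1), PowerSeries.coeff k f := by
  rw [mul_comm, PowerSeries.coeff_mul, Finset.Nat.sum_antidiagonal_eq_sum_range_succ_mk]
  simp [invOneSub_eq]

theorem coeff_coeff_invOneSub_mul_formalSum {f : ℕ → Ser} (h : ∀ n, xVar ^ n ∣ f n) (i j : ℕ) :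
    PowerSeries.coeff j (PowerSeries.coeff i (invOneSub * formalSum f)) =
      ∑ n ∈ Finset.range (j + 1),
        PowerSeries.coeff j (PowerSeries.coeff i (invOneSub * f n)) := by
  simp only [coeff_invOneSub_mul, map_sum, coeff_coeff_formalSum h]
  exact Finset.sum_comm

theorem coeff_hadamardPow (f : Ser) (i n : ℕ) :
    PowerSeries.coeff i (hadamardPow f n) = PowerSeries.coeff i f ^ n := by
  induction n with
  | zero => simp [hadamardPow, invOneSub_eq]
  | succ n ih => rw [hadamardPow, hadamard, PowerSeries.coeff_mk, ih, pow_succ]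

/-! ### The terms of the two series count words -/

theorem coeff_invOneSub_mul_sum_perm {n : ℕ} (g : Equiv.Perm (Fin n) → Polynomial ℚ) (k : ℕ) :
    PowerSeries.coeff k (invOneSub * ((∑ π : Equiv.Perm (Fin n),
        PowerSeries.C (PowerSeries.C (g π)) * uSer ^ ilpk π) * zSer ^ n)) =
      PowerSeries.X ^ n *
        PowerSeries.C (∑ w : Fin n → Fin (2 * k + 1), g (standardize w)) := by
  rw [Finset.sum_mul, Finset.mul_sum, map_sum,
    ← Finset.sum_fiberwise (s := Finset.univ) (g := fun w => standardize w), map_sum,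
    Finset.mul_sum]
  refine Finset.sum_congr rfl fun π _ => ?_
  rw [mul_assoc, mul_left_comm, PowerSeries.coeff_C_mul, coeff_invOneSub_mul_pow_ilpk,
    Finset.sum_congr rfl fun w hw => by rw [(Finset.mem_filter.1 hw).2], Finset.sum_const,
    nsmul_eq_mul, map_mul, map_natCast]
  ring

theorem ilpkTerm_eq {Γ : Set AllPerm} (hΓ : ∀ σ ∈ Γ, 2 ≤ σ.1) (n : ℕ) :
    ilpkTerm Γ n = (∑ π : Equiv.Perm (Fin n),
      PowerSeries.C (PowerSeries.C (Polynomial.X ^ occ Γ π)) * uSer ^ ilpk π) * zSer ^ n := by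
  rw [ilpkTerm, ilpkPoly]
  split_ifs with h
  -- The conventional value `1` is also what the empty permutation contributes.
  · subst h
    simp [occ, occurrences_eq_empty hΓ, ilpk, lpk]
  · simp [sVar]

theorem ilpkClusterTerm_eq (Γ : Set AllPerm) (k : ℕ) :
    ilpkClusterTerm Γ k = (∑ π : Equiv.Perm (Fin k),
      PowerSeries.C (PowerSeries.C (∑ c ∈ clusters Γ π, (Polynomial.X - 1) ^ c.card)) *
        uSer ^ ilpk π) * zSer ^ k := by
  simp [ilpkClusterTerm, ilpkClusterPoly, sVar, mul_comm]

theorem xVar_pow_dvd_mul_zSer_pow (f : Ser) (n : ℕ) : xVar ^ n ∣ f * zSer ^ n := by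
  rw [zSer_pow]
  exact (dvd_mul_right _ _).mul_left f

/-- The isolated `z` of the formula is thus the missing term `k = 1`: a single unmarked letter is a
cluster. -/
theorem ilpkClusterTerm_one {Γ : Set AllPerm} (hΓ : ∀ σ ∈ Γ, 2 ≤ σ.1) :
    ilpkClusterTerm Γ 1 = zSer := by
  have h1 : ∀ π : Equiv.Perm (Fin 1), ilpk π = 0 := fun π => by
    simp [ilpk, lpk_eq_runCount, runCount]
  have h2 : ∀ π : Equiv.Perm (Fin 1), clusters Γ π = {∅} := fun π => by
    ext T
    simp only [clusters, occurrences_eq_empty hΓ one_lt_two, Finset.powerset_empty,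
      Finset.mem_filter, Finset.mem_singleton, and_iff_left_iff_imp]
    rintro rfl
    refine ⟨Finset.empty_subset _, ?_⟩
    rintro ⟨a, b, -, -, -, -, ha, hb, -, -, hn, -⟩
    omega
  rw [ilpkClusterTerm_eq]
  simp [h1, h2]

/-- The constant term is set to `0` by hand: the empty word is vacuously a cluster but must not be
counted. -/
theorem coeff_clusterSeries {Γ : Set AllPerm} (hΓ : ∀ σ ∈ Γ, 2 ≤ σ.1) (k : ℕ) :
    PowerSeries.coeff k (zSer * invOneSub +
        invOneSub * formalSum (fun n => ilpkClusterTerm Γ (n + 2))) =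
      PowerSeries.mk fun j => if j = 0 then 0 else
        clusterWordSum Γ (Polynomial.X - 1 : Polynomial ℚ) (2 * k + 1) j := by
  have hterm : ∀ n, PowerSeries.coeff k (invOneSub * ilpkClusterTerm Γ n) =
      PowerSeries.X ^ n * PowerSeries.C
        (clusterWordSum Γ (Polynomial.X - 1 : Polynomial ℚ) (2 * k + 1) n) := fun n => by
    rw [ilpkClusterTerm_eq, coeff_invOneSub_mul_sum_perm]
    rfl
  have hdvd : ∀ n, xVar ^ n ∣ ilpkClusterTerm Γ (n + 2) := fun n =>
    (pow_dvd_pow _ (Nat.le_add_right n 2)).trans (xVar_pow_dvd_mul_zSer_pow _ _)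
  ext1 j
  rw [map_add, map_add, coeff_coeff_invOneSub_mul_formalSum hdvd, mul_comm zSer,
    ← ilpkClusterTerm_one hΓ, PowerSeries.coeff_mk]
  simp only [hterm, PowerSeries.coeff_mul_C, PowerSeries.coeff_X_pow, ite_mul, one_mul, zero_mul]
  rcases j with _ | _ | j
  · simp
  · simp
  · rw [Finset.sum_eq_single j]
    · simp
    · intro b _ hb
      rw [if_neg (by omega)]
    · intro h
      exact absurd (Finset.mem_range.2 (by omega)) h

theorem coeff_coeff_ilpkSeries {Γ : Set AllPerm} (hΓ : ∀ σ ∈ Γ, 2 ≤ σ.1) (k j : ℕ) :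
    PowerSeries.coeff j (PowerSeries.coeff k (invOneSub * formalSum (fun n => ilpkTerm Γ n))) =
      markedWordSum Γ (Polynomial.X - 1 : Polynomial ℚ) (2 * k + 1) j := by
  rw [coeff_coeff_invOneSub_mul_formalSum (f := fun n => ilpkTerm Γ n)
    fun n => xVar_pow_dvd_mul_zSer_pow _ n, markedWordSum_eq_sum_pow_occ, sub_add_cancel]
  simp only [ilpkTerm_eq hΓ, coeff_invOneSub_mul_sum_perm, PowerSeries.coeff_mul_C,
    PowerSeries.coeff_X_pow, ite_mul, one_mul, zero_mul]
  simp

/-- Geometric series: the remainder `f^(j+1) M` is divisible by `X^(j+1)`. -/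
theorem coeff_eq_sum_coeff_pow {A : Type*} [CommRing A] {f M : PowerSeries A}
    (hf : PowerSeries.X ∣ f) (h : (1 - f) * M = 1) (j : ℕ) :
    PowerSeries.coeff j M = ∑ n ∈ Finset.range (j + 1), PowerSeries.coeff j (f ^ n) := by
  have h1 : M = ∑ n ∈ Finset.range (j + 1), f ^ n + f ^ (j + 1) * M := by
    linear_combination (∑ n ∈ Finset.range (j + 1), f ^ n) * h
      - M * mul_neg_geom_sum f (j + 1)
  obtain ⟨g, hg⟩ := pow_dvd_pow_of_dvd hf (j + 1)
  rw [hg, mul_assoc] at h1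
  conv_lhs => rw [h1]
  rw [map_add, map_sum, PowerSeries.coeff_X_pow_mul', if_neg (by omega), add_zero]

theorem one_sub_mk_mul_mk {A : Type*} [CommRing A] {c m : ℕ → A} (h0 : m 0 = 1)
    (h : ∀ n, 0 < n → m n = ∑ a ∈ Finset.Icc 1 n, c a * m (n - a)) :
    (1 - PowerSeries.mk fun j => if j = 0 then 0 else c j) * PowerSeries.mk m = 1 := by
  ext n
  rw [sub_mul, one_mul, map_sub, PowerSeries.coeff_mul, PowerSeries.coeff_mk,
    Finset.Nat.sum_antidiagonal_eq_sum_range_succ_mk, Finset.sum_range_succ']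
  simp only [PowerSeries.coeff_mk, if_pos, zero_mul, add_zero, Nat.add_one_ne_zero, if_false]
  rcases Nat.eq_zero_or_pos n with rfl | hn
  · simp [h0]
  · rw [h n hn, PowerSeries.coeff_one, if_neg hn.ne', sub_eq_zero, Finset.range_eq_Ico,
      Finset.sum_Ico_add' (fun a => c a * m (n - a)) 0 n 1]
    rfl

end ClusterMethod

theorem theorem3p7 (Γ : Set AllPerm) (hΓ : ∀ σ ∈ Γ, 2 ≤ σ.1) :
    FormallySummable (fun n => ilpkTerm Γ n) ∧
    FormallySummable (fun k => ilpkClusterTerm Γ (k + 2)) ∧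
    FormallySummable (fun n => hadamardPow
      (zSer * invOneSub + invOneSub * formalSum (fun k => ilpkClusterTerm Γ (k + 2))) n) ∧
    invOneSub * formalSum (fun n => ilpkTerm Γ n) =
      formalSum (fun n => hadamardPow
        (zSer * invOneSub + invOneSub * formalSum (fun k => ilpkClusterTerm Γ (k + 2))) n) := by
  have hX : ∀ k, PowerSeries.X ∣ PowerSeries.coeff k (zSer * invOneSub +
      invOneSub * formalSum (fun n => ilpkClusterTerm Γ (n + 2))) := fun k => by
    rw [coeff_clusterSeries hΓ, PowerSeries.X_dvd_iff]
    simp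
  have hdvd : ∀ n, xVar ^ n ∣ hadamardPow (zSer * invOneSub +
      invOneSub * formalSum (fun k => ilpkClusterTerm Γ (k + 2))) n := fun n => by
    -- As `x` is constant in `t`, the quotient by `x^n` is assembled coefficient by coefficient in
    -- `t`.
    choose g hg using fun k => pow_dvd_pow_of_dvd (hX k) n
    refine ⟨PowerSeries.mk g, ?_⟩
    ext1 k
    rw [coeff_hadamardPow, hg, coeff_xVar_pow_mul, PowerSeries.coeff_mk]
  refine ⟨formallySummable_of_xVar_pow_dvd fun n => xVar_pow_dvd_mul_zSer_pow _ n,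
    formallySummable_of_xVar_pow_dvd fun n =>
      (pow_dvd_pow _ (Nat.le_add_right n 2)).trans (xVar_pow_dvd_mul_zSer_pow _ _),
    formallySummable_of_xVar_pow_dvd hdvd, ?_⟩
  ext1 k
  ext1 j
  rw [coeff_coeff_ilpkSeries hΓ, coeff_coeff_formalSum hdvd]
  simp only [coeff_hadamardPow]
  have hf := coeff_clusterSeries hΓ k
  have h := one_sub_mk_mul_mk
    (markedWordSum_zero hΓ (Polynomial.X - 1 : Polynomial ℚ) (2 * k + 1))
    (fun n hn => markedWordSum_eq hΓ (Polynomial.X - 1 : Polynomial ℚ) (2 * k + 1) hn)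
  rw [← hf] at h
  rw [← coeff_eq_sum_coeff_pow (hX k) h, PowerSeries.coeff_mk]
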